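/- Let $\gamma, a_1, a_2 > 0$ and let $(A,B,C)$, with $A \in \mathbb{R}^{2\times 2}$ and $B, C^{T} \in \mathbb{R}^2$, be any (minimal) two-dimensional state space realization of the plant without finite zero $$C(sI-A)^{-1}B = \frac{\gamma}{s^2+a_1 s+a_2},$$ for instance $A=\begin{pmatrix}0&-a_2\\1&-a_1\end{pmatrix}$, $B=\begin{pmatrix}\gamma\\0\end{pmatrix}$, $C=\begin{pmatrix}0&1\end{pmatrix}$. Consider the relay feedback system $\dot x = Ax - B\,\mathrm{sign}(Cx)$, $x\in\mathbb{R}^2$. A trajectory is a Filippov solution on $[0,\infty)$, i.e. a function $x:[0,\infty)\to\mathbb{R}^2$, absolutely continuous on every interval $[0,T]$, such that for almost every $t \ge 0$ $$\dot x(t)\in\begin{cases}\{Ax(t)-B\}, & Cx(t)>0,\\ \{Ax(t)-uB : u\in[-1,1]\}, & Cx(t)=0,\\ \{Ax(t)+B\}, & Cx(t)<0.\end{cases}$$ Then from every initial state $x_0\in\mathbb{R}^2$ there starts at least one trajectory, and every trajectory converges asymptotically to the origin: $x(t)\to 0$ as $t\to\infty$. -/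

import Mathlib

open Filter Topology MeasureTheory
open scoped Matrix Polynomial

noncomputable section

namespace RelayFeedback

/-- The transfer function `C (sI - A)⁻¹ B` of the single-input single-output linear system
`ẋ = A x + B u`, `y = C x` with state space `ℝ²`, as a rational function of `s`.
The matrix `sI - A` is invertible over `ℝ(s)`, its determinant being the (monic) characteristic
polynomial of `A`. -/
def transferFunction (A : Matrix (Fin 2) (Fin 2) ℝ) (B C : Fin 2 → ℝ) : RatFunc ℝ :=
  (fun i => algebraMap ℝ (RatFunc ℝ) (C i)) ⬝ᵥ
    ((A.charmatrix.map (algebraMap ℝ[X] (RatFunc ℝ)))⁻¹ *ᵥ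
      fun i => algebraMap ℝ (RatFunc ℝ) (B i))

/-- The ideal relay as a set-valued map: the sign of `y`, with all the values of `[-1, 1]`
at the switching value `y = 0`. -/
def relay (y : ℝ) : Set ℝ :=
  if 0 < y then {1} else if y < 0 then {-1} else Set.Icc (-1) 1

/-- The right-hand side at the state `x` of the Filippov differential inclusion for
`ẋ = A x - B sign (C x)`. -/
def filippovField (A : Matrix (Fin 2) (Fin 2) ℝ) (B C : Fin 2 → ℝ) (x : Fin 2 → ℝ) :
    Set (Fin 2 → ℝ) :=
  {v | ∃ u ∈ relay (C ⬝ᵥ x), v = A *ᵥ x - u • B}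

/-- `x` (restricted to `[0, ∞)`) is a trajectory of the relay feedback system, that is, a Filippov
solution of `ẋ = A x - B sign (C x)` on `[0, ∞)`: it is absolutely continuous on every compact
interval `[0, T]` and satisfies the differential inclusion at almost every time. -/
def IsTrajectory (A : Matrix (Fin 2) (Fin 2) ℝ) (B C : Fin 2 → ℝ) (x : ℝ → Fin 2 → ℝ) : Prop :=
  (∀ T : ℝ, 0 < T → AbsolutelyContinuousOnInterval x 0 T) ∧
    ∀ᵐ t ∂(volume.restrict (Set.Ici (0 : ℝ))), ∃ v ∈ filippovField A B C (x t), HasDerivAt x v t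

end RelayFeedback

end

/-! The transfer function forces CB = 0, CAB = γ and fixes the trace and determinant of A. By
Cayley–Hamilton, y = Cx and z = CAx satisfy y' = z, z' = -a₂y - a₁z - γu with u in the relay set of
y. The energy z²/2 + a₂y²/2 + γ|y| has derivative -a₁z², the relay terms cancelling because |y|' =
uz almost everywhere, also while y = 0. A small cross term εyz makes the decay strict, so `lyapunov`
decays exponentially. As C and CA are independent, x tends to 0 (`IsTrajectory.tendsto_zero`).

Existence holds for any A, B, C. Euler schemes and their integrated controls have limits x and U
along an ultrafilter (`exists_euler_limit`). U is 1-Lipschitz, so it has a derivative u in [-1, 1]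
almost everywhere, equal to the sign of Cx where Cx ≠ 0; quadratic error bounds give x' = Ax - uB
there. -/

namespace RelayFeedback

/-! ### Markov parameters from the transfer function -/

/-- Comparing numerators and denominators of the transfer function determines the first two
Markov parameters and the characteristic polynomial of the realization. -/
theorem markov_of_transferFunction_eq {γ a₁ a₂ : ℝ} (hγ : γ ≠ 0)
    {A : Matrix (Fin 2) (Fin 2) ℝ} {B C : Fin 2 → ℝ}
    (h : transferFunction A B C =
      RatFunc.C γ / (RatFunc.X ^ 2 + RatFunc.C a₁ * RatFunc.X + RatFunc.C a₂)) :
    C ⬝ᵥ B = 0 ∧ C ⬝ᵥ (A *ᵥ B) = γ ∧ A 0 0 + A 1 1 = -a₁ ∧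
      A 0 0 * A 1 1 - A 0 1 * A 1 0 = a₂ := by
  set φ : ℝ[X] →+* RatFunc ℝ := algebraMap ℝ[X] (RatFunc ℝ) with hφ
  have hinj : Function.Injective φ := RatFunc.algebraMap_injective ℝ
  set p : ℝ[X] := (Polynomial.X - Polynomial.C (A 0 0)) * (Polynomial.X - Polynomial.C (A 1 1))
    - Polynomial.C (A 0 1) * Polynomial.C (A 1 0) with hp
  set q : ℝ[X] := Polynomial.X ^ 2 + Polynomial.C a₁ * Polynomial.X + Polynomial.C a₂ with hq
  set r : ℝ[X] :=
    Polynomial.C (C 0) * ((Polynomial.X - Polynomial.C (A 1 1)) * Polynomial.C (B 0)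
      + Polynomial.C (A 0 1) * Polynomial.C (B 1))
    + Polynomial.C (C 1) * (Polynomial.C (A 1 0) * Polynomial.C (B 0)
      + (Polynomial.X - Polynomial.C (A 0 0)) * Polynomial.C (B 1)) with hr
  have hp0 : φ p ≠ 0 := by
    rw [map_ne_zero_iff φ hinj]
    have : p = A.charpoly := by
      rw [Matrix.charpoly, Matrix.det_fin_two]
      simp [hp]
    rw [this]
    exact A.charpoly_monic.ne_zero
  have hq0 : φ q ≠ 0 := by
    rw [map_ne_zero_iff φ hinj]
    intro h0
    have := congrArg (fun q => Polynomial.coeff q 2) h0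
    simp [hq] at this
  have hleft : transferFunction A B C = φ r / φ p := by
    rw [transferFunction, Matrix.inv_def, Matrix.det_fin_two, Matrix.adjugate_fin_two,
      Ring.inverse_eq_inv']
    have hdet : φ p = (RatFunc.X - RatFunc.C (A 0 0)) * (RatFunc.X - RatFunc.C (A 1 1))
        - RatFunc.C (A 0 1) * RatFunc.C (A 1 0) := by
      simp [hp, hφ]
    rw [hdet]
    simp [Matrix.mulVec, dotProduct, Fin.sum_univ_two, hr, hφ, RatFunc.algebraMap_eq_C]
    ring
  have hright : RatFunc.C γ / (RatFunc.X ^ 2 + RatFunc.C a₁ * RatFunc.X + RatFunc.C a₂)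
      = φ (Polynomial.C γ) / φ q := by
    simp [hq, hφ]
  rw [hleft, hright, div_eq_div_iff hp0 hq0, ← map_mul, ← map_mul] at h
  have hpoly := hinj h
  have hev (s : ℝ) := congrArg (Polynomial.eval s) hpoly
  simp only [hp, hq, hr, Polynomial.eval_mul, Polynomial.eval_add, Polynomial.eval_sub,
    Polynomial.eval_pow, Polynomial.eval_X, Polynomial.eval_C] at hev
  -- The identity has degree at most 3, so four points determine it; its coefficients from the top
  -- down give CB, CAB, trace and determinant.
  have e0 := hev 0
  have e1 := hev 1
  have e2 := hev (-1)
  have e3 := hev 2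
  have hCB : C 0 * B 0 + C 1 * B 1 = 0 := by linarith
  have hk : C 0 * (A 0 0 * B 0 + A 0 1 * B 1) + C 1 * (A 1 0 * B 0 + A 1 1 * B 1) = γ := by
    linear_combination (1 / 2) * e1 + (1 / 2) * e2 - e0 + (A 0 0 + A 1 1 - a₁) * hCB
  have htr : γ * (A 0 0 + A 1 1) = γ * (-a₁) := by
    linear_combination (1 / 2) * e1 - (1 / 2) * e2 - a₁ * hk +
      (a₁ * (A 0 0 + A 1 1) - 1 - a₂) * hCB
  have hdet : γ * (A 0 0 * A 1 1 - A 0 1 * A 1 0) = γ * a₂ := by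
    linear_combination - e0 + a₂ * hk - a₂ * (A 0 0 + A 1 1) * hCB
  refine ⟨?_, ?_, mul_left_cancel₀ hγ htr, mul_left_cancel₀ hγ hdet⟩
  · simpa [dotProduct, Fin.sum_univ_two] using hCB
  · simpa [Matrix.mulVec, dotProduct, Fin.sum_univ_two] using hk

end RelayFeedback

/-! ### Absolute continuity and derivatives of absolute values -/

/-- Composing an absolutely continuous function with a Lipschitz map yields an absolutely
continuous function. -/
theorem LipschitzWith.comp_absolutelyContinuousOnInterval {X Y : Type*} [PseudoMetricSpace X]
    [PseudoMetricSpace Y] {K : NNReal} {g : X → Y} (hg : LipschitzWith K g) {f : ℝ → X} {a b : ℝ}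
    (hf : AbsolutelyContinuousOnInterval f a b) :
    AbsolutelyContinuousOnInterval (fun t => g (f t)) a b := by
  unfold AbsolutelyContinuousOnInterval at hf ⊢
  refine squeeze_zero (fun E => Finset.sum_nonneg fun i _ => dist_nonneg) (fun E => ?_)
    (by simpa using hf.const_mul (K : ℝ))
  rw [Finset.mul_sum]
  exact Finset.sum_le_sum fun i _ => hg.dist_le_mul _ _

/-- An absolutely continuous function with almost everywhere nonpositive derivative does not
increase. -/
theorem AbsolutelyContinuousOnInterval.le_of_ae_deriv_nonpos {f : ℝ → ℝ} {a b : ℝ}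
    (hab : a ≤ b) (hf : AbsolutelyContinuousOnInterval f a b)
    (h : ∀ᵐ t, t ∈ Set.Ioc a b → deriv f t ≤ 0) : f b ≤ f a := by
  rw [← sub_nonpos, ← hf.integral_deriv_eq_sub, intervalIntegral.integral_of_le hab]
  refine integral_nonpos_of_ae ?_
  exact (ae_restrict_iff' measurableSet_Ioc).2 h

/-- A function with an interior zero `t` at which both it and its absolute value are
differentiable has a stationary point there. -/
theorem HasDerivAt.eq_zero_of_differentiableAt_abs {f : ℝ → ℝ} {f' t : ℝ}
    (hf : HasDerivAt f f' t) (h0 : f t = 0) (habs : DifferentiableAt ℝ (fun s => |f s|) t) :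
    f' = 0 := by
  have hmin : IsLocalMin (fun s => |f s|) t :=
    Filter.Eventually.of_forall fun s => by simp [h0]
  have hd : HasDerivAt (fun s => |f s|) 0 t := by
    rw [← hmin.deriv_eq_zero]
    exact habs.hasDerivAt
  rw [hasDerivAt_iff_tendsto_slope] at hf hd
  have h1 := hf.abs
  have h2 := hd.abs
  -- As f vanishes at t, the slopes of f and |f| there agree in absolute value.
  have : (fun s => |slope f t s|) = fun s => |slope (fun s => |f s|) t s| := by
    ext s
    simp [slope_def_field, h0, abs_div]
  rw [this] at h1
  simpa using tendsto_nhds_unique h1 h2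

/-! ### Strict Lyapunov function -/

namespace RelayFeedback

theorem mul_eq_abs_of_mem_relay {y u : ℝ} (hu : u ∈ relay y) : u * y = |y| := by
  unfold relay at hu
  split_ifs at hu with h1 h2
  · rw [Set.mem_singleton_iff.1 hu, abs_of_pos h1, one_mul]
  · rw [Set.mem_singleton_iff.1 hu, abs_of_neg h2, neg_one_mul]
  · have : y = 0 := le_antisymm (not_lt.1 h1) (not_lt.1 h2)
    simp [this]

/-- The coefficient of the cross term in the strict Lyapunov function. -/
theorem exists_crossCoefficient {a₁ a₂ : ℝ} (ha₁ : 0 < a₁) (ha₂ : 0 < a₂) :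
    ∃ ε : ℝ, 0 < ε ∧ 16 * ε ^ 2 ≤ a₂ ∧ 2 * ε ≤ a₁ ∧ 2 * (ε * a₁) ≤ a₂ := by
  have h1 : 0 < a₁ ^ 2 + a₂ := by positivity
  -- 1/ε is the sum of 2/a₁ and 2a₁/a₂, so ε lies below both reciprocals; the first bound is AM-GM
  -- for a₁² and a₂.
  refine ⟨a₁ * a₂ / (2 * (a₁ ^ 2 + a₂)), by positivity, ?_, ?_, ?_⟩
  · rw [div_pow, mul_div_assoc', div_le_iff₀ (by positivity)]
    have : 4 * (a₁ ^ 2 * a₂) ≤ (a₁ ^ 2 + a₂) ^ 2 := by nlinarith [sq_nonneg (a₁ ^ 2 - a₂)]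
    nlinarith [mul_le_mul_of_nonneg_left this ha₂.le]
  · rw [mul_div_assoc', div_le_iff₀ (by positivity)]
    nlinarith [pow_pos ha₁ 3, mul_pos ha₁ ha₂]
  · rw [div_mul_eq_mul_div, mul_div_assoc', div_le_iff₀ (by positivity)]
    nlinarith [mul_pos (pow_pos ha₁ 2) ha₂, pow_pos ha₂ 2]

/-- The strict Lyapunov function of the relay system in the coordinates `y = C x`, `z = C A x`:
the energy plus a small cross term. -/
noncomputable def lyapunov (γ a₂ ε y z : ℝ) : ℝ :=
  z * z / 2 + a₂ * (y * y) / 2 + γ * |y| + ε * (y * z)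

theorem abs_cross_le {a₂ ε : ℝ} (hε : 16 * ε ^ 2 ≤ a₂) (y z : ℝ) :
    |ε * (y * z)| ≤ (z * z + a₂ * (y * y)) / 8 := by
  rw [abs_le]
  constructor <;>
    nlinarith [sq_nonneg (z + 4 * ε * y), sq_nonneg (z - 4 * ε * y),
      mul_le_mul_of_nonneg_right hε (sq_nonneg y)]

theorem le_lyapunov {γ a₂ ε : ℝ} (hγ : 0 ≤ γ) (hε : 16 * ε ^ 2 ≤ a₂) (y z : ℝ) :
    (z * z + a₂ * (y * y)) / 4 ≤ lyapunov γ a₂ ε y z := by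
  have h1 := (abs_le.1 (abs_cross_le hε y z)).1
  have h2 : 0 ≤ γ * |y| := by positivity
  have h3 : 0 ≤ a₂ * (y * y) := mul_nonneg ((by positivity : 0 ≤ 16 * ε ^ 2).trans hε)
    (mul_self_nonneg y)
  unfold lyapunov
  nlinarith [mul_self_nonneg z]

/-- The cross term supplies the decay in y that friction lacks; Young's inequality on εa₁yz and the
smallness of ε let -a₁z² absorb what it costs in z. -/
theorem lyapunov_decay {γ a₁ a₂ ε : ℝ} (hγ : 0 ≤ γ) (hε : 0 < ε) (h16 : 16 * ε ^ 2 ≤ a₂)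
    (h2 : 2 * ε ≤ a₁) (h3 : 2 * (ε * a₁) ≤ a₂) (y z : ℝ) :
    -(a₁ * (z * z)) + ε * (z * z + y * (-a₂ * y - a₁ * z) - γ * |y|)
      ≤ -(ε / 2) * lyapunov γ a₂ ε y z := by
  have ha₁ : 0 < a₁ := by linarith
  have hcross : -(ε * a₁ * (y * z)) ≤ ε * a₂ * (y * y) / 2 + a₁ * (z * z) / 4 := by
    have e1 : 0 ≤ a₁ * (ε * y + z / 2) ^ 2 := by positivity
    have e2 : 2 * (ε * a₁) * (ε * (y * y)) ≤ a₂ * (ε * (y * y)) :=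
      mul_le_mul_of_nonneg_right h3 (mul_nonneg hε.le (mul_self_nonneg y))
    nlinarith
  have hW : lyapunov γ a₂ ε y z ≤ 5 / 8 * (z * z + a₂ * (y * y)) + γ * |y| := by
    have := (abs_le.1 (abs_cross_le h16 y z)).2
    unfold lyapunov
    linarith
  have hW' := mul_le_mul_of_nonneg_left hW (half_pos hε).le
  have hy : 0 ≤ ε * (γ * |y|) := by positivity
  have hyy : 0 ≤ ε * (a₂ * (y * y)) :=
    mul_nonneg hε.le (mul_nonneg ((by positivity : 0 ≤ 16 * ε ^ 2).trans h16) (mul_self_nonneg y))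
  have hzz : 2 * ε * (z * z) ≤ a₁ * (z * z) := mul_le_mul_of_nonneg_right h2 (mul_self_nonneg z)
  have hzz' : 0 ≤ a₁ * (z * z) := mul_nonneg ha₁.le (mul_self_nonneg z)
  linarith

/-- The derivative of the Lyapunov function along the relay system. -/
theorem hasDerivAt_lyapunov {γ a₁ a₂ ε t u : ℝ} {y z : ℝ → ℝ} (hu : u ∈ relay (y t))
    (hy : HasDerivAt y (z t) t) (hz : HasDerivAt z (-a₂ * y t - a₁ * z t - γ * u) t)
    (habs : DifferentiableAt ℝ (fun s => |y s|) t) :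
    HasDerivAt (fun s => lyapunov γ a₂ ε (y s) (z s))
      (-(a₁ * (z t * z t)) + ε * (z t * z t + y t * (-a₂ * y t - a₁ * z t) - γ * |y t|)) t := by
  have h1 : HasDerivAt (fun s => |y s|) (u * z t) t := by
    -- At a zero of y the value of u is not determined, but differentiability of |y| forces z = 0,
    -- so uz is still the derivative.
    by_cases h0 : y t = 0
    · have hz0 := hy.eq_zero_of_differentiableAt_abs h0 habs
      have hmin : IsLocalMin (fun s => |y s|) t :=
        Filter.Eventually.of_forall fun s => by simp [h0]
      rw [hz0, mul_zero, ← hmin.deriv_eq_zero]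
      exact habs.hasDerivAt
    · have hsign : u = SignType.sign (y t) := by
        unfold relay at hu
        split_ifs at hu with h1 h2
        · simp [Set.mem_singleton_iff.1 hu, h1]
        · simp [Set.mem_singleton_iff.1 hu, h2]
        · exact absurd (le_antisymm (not_lt.1 h1) (not_lt.1 h2)) h0
      rw [hsign]
      exact (hasDerivAt_abs h0).comp t hy
  have hmul := mul_eq_abs_of_mem_relay hu
  have h := ((((hz.mul hz).div_const 2).add (((hy.mul hy).const_mul a₂).div_const 2)).add
    (h1.const_mul γ)).add ((hy.mul hz).const_mul ε)
  refine h.congr_deriv ?_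
  rw [← hmul]
  ring

/-- Every solution of the relay system in the coordinates `y = C x`, `z = C A x` tends to `0`. -/
theorem tendsto_zero_of_relay {γ a₁ a₂ : ℝ} (hγ : 0 < γ) (ha₁ : 0 < a₁) (ha₂ : 0 < a₂)
    {y z : ℝ → ℝ} (hy : ∀ T : ℝ, 0 < T → AbsolutelyContinuousOnInterval y 0 T)
    (hz : ∀ T : ℝ, 0 < T → AbsolutelyContinuousOnInterval z 0 T)
    (h : ∀ᵐ t ∂(volume.restrict (Set.Ici (0 : ℝ))), ∃ u ∈ relay (y t),
      HasDerivAt y (z t) t ∧ HasDerivAt z (-a₂ * y t - a₁ * z t - γ * u) t) :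
    Tendsto y atTop (𝓝 0) ∧ Tendsto z atTop (𝓝 0) := by
  obtain ⟨ε, hε, h16, h2, h3⟩ := exists_crossCoefficient ha₁ ha₂
  set W : ℝ → ℝ := fun s => lyapunov γ a₂ ε (y s) (z s) with hW
  have hbound : ∀ T : ℝ, 0 < T → W T ≤ W 0 * Real.exp (-(ε / 2) * T) := by
    intro T hT
    have habs := lipschitzWith_one_norm.comp_absolutelyContinuousOnInterval (hy T hT)
    simp only [Real.norm_eq_abs] at habs
    have hWac : AbsolutelyContinuousOnInterval W 0 T := by
      have e1 := ((hz T hT).fun_mul (hz T hT)).const_mul (1 / 2)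
      have e2 := ((hy T hT).fun_mul (hy T hT)).const_mul (a₂ / 2)
      have e := ((e1.fun_add e2).fun_add (habs.const_mul γ)).fun_add
        (((hy T hT).fun_mul (hz T hT)).const_mul ε)
      refine (congrArg (AbsolutelyContinuousOnInterval · 0 T) (funext fun s => ?_)).mp e
      simp only [hW, lyapunov]
      ring
    have hexp : AbsolutelyContinuousOnInterval (fun s => Real.exp (ε / 2 * s)) 0 T :=
      ContDiffOn.absolutelyContinuousOnInterval (by fun_prop)
    -- Gronwall in integrated form: exp(εs/2) W(s) is absolutely continuous with nonpositive
    -- derivative almost everywhere.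
    have key := (hexp.fun_mul hWac).le_of_ae_deriv_nonpos hT.le ?_
    · simp only [mul_zero, Real.exp_zero, one_mul] at key
      have hpos := Real.exp_pos (ε / 2 * T)
      rw [neg_mul, Real.exp_neg, ← div_eq_mul_inv, le_div_iff₀ hpos, mul_comm]
      exact key
    · filter_upwards [(ae_restrict_iff' measurableSet_Ici).1 h, habs.ae_differentiableAt]
        with t ht habst htI
      obtain ⟨u, hu, hyt, hzt⟩ := ht htI.1.le
      have hd := habst (by rw [Set.uIcc_of_le hT.le]; exact ⟨htI.1.le, htI.2⟩)
      have hWt := hasDerivAt_lyapunov (ε := ε) hu hyt hzt hd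
      have hE : HasDerivAt (fun s => Real.exp (ε / 2 * s)) (Real.exp (ε / 2 * t) * (ε / 2)) t := by
        simpa using ((hasDerivAt_id t).const_mul (ε / 2)).exp
      rw [(hE.fun_mul hWt).deriv]
      have hdec := lyapunov_decay hγ.le hε h16 h2 h3 (y t) (z t)
      have := mul_le_mul_of_nonneg_left hdec (Real.exp_pos (ε / 2 * t)).le
      nlinarith
  have hlim : Tendsto (fun T => 4 * (W 0 * Real.exp (-(ε / 2) * T))) atTop (𝓝 0) := by
    have : Tendsto (fun T : ℝ => -(ε / 2) * T) atTop atBot :=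
      tendsto_id.const_mul_atTop_of_neg (by linarith)
    simpa using ((Real.tendsto_exp_atBot.comp this).const_mul (W 0)).const_mul 4
  have hsum : ∀ T : ℝ, 0 < T →
      z T * z T + a₂ * (y T * y T) ≤ 4 * (W 0 * Real.exp (-(ε / 2) * T)) := by
    intro T hT
    have := le_lyapunov hγ.le h16 (y T) (z T)
    have := hbound T hT
    simp only [hW] at *
    linarith
  have hsq {w : ℝ → ℝ} (hw : Tendsto (fun t => w t ^ 2) atTop (𝓝 0)) : Tendsto w atTop (𝓝 0) := by
    rw [tendsto_zero_iff_abs_tendsto_zero]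
    simpa [Function.comp_def, Real.sqrt_sq_eq_abs] using hw.sqrt
  constructor
  · have hlim' := hlim.const_mul a₂⁻¹
    rw [mul_zero] at hlim'
    refine hsq (squeeze_zero' (Eventually.of_forall fun t => sq_nonneg _) ?_ hlim')
    filter_upwards [eventually_gt_atTop 0] with T hT
    rw [inv_mul_eq_div, le_div_iff₀ ha₂]
    nlinarith [hsum T hT, mul_self_nonneg (z T)]
  · refine hsq (squeeze_zero' (Eventually.of_forall fun t => sq_nonneg _) ?_ hlim)
    filter_upwards [eventually_gt_atTop 0] with T hT
    nlinarith [hsum T hT, mul_nonneg ha₂.le (mul_self_nonneg (y T))]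

/-! ### Convergence of the state -/

/-- The linear functional `x ↦ c ⬝ᵥ x` on the state space. -/
noncomputable def dotCLM (c : Fin 2 → ℝ) : (Fin 2 → ℝ) →L[ℝ] ℝ :=
  LinearMap.toContinuousLinearMap (dotProductBilin ℝ ℝ c)

@[simp]
theorem dotCLM_apply (c x : Fin 2 → ℝ) : dotCLM c x = c ⬝ᵥ x := rfl

/-- Trajectories of the relay feedback system converge to the origin. -/
theorem IsTrajectory.tendsto_zero {γ a₁ a₂ : ℝ} (hγ : 0 < γ) (ha₁ : 0 < a₁) (ha₂ : 0 < a₂)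
    {A : Matrix (Fin 2) (Fin 2) ℝ} {B C : Fin 2 → ℝ} (hCB : C ⬝ᵥ B = 0)
    (hCAB : C ⬝ᵥ (A *ᵥ B) = γ) (htr : A 0 0 + A 1 1 = -a₁)
    (hdet : A 0 0 * A 1 1 - A 0 1 * A 1 0 = a₂) {x : ℝ → Fin 2 → ℝ}
    (hx : IsTrajectory A B C x) : Tendsto x atTop (𝓝 0) := by
  set d : Fin 2 → ℝ := C ᵥ* A with hd
  have hdB : d ⬝ᵥ B = γ := by rw [hd, ← Matrix.dotProduct_mulVec, hCAB]
  -- Cayley–Hamilton, applied on the left to C.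
  have hdA : ∀ v, d ⬝ᵥ (A *ᵥ v) = -a₂ * (C ⬝ᵥ v) - a₁ * (d ⬝ᵥ v) := by
    intro v
    simp only [hd, Matrix.mulVec, Matrix.vecMul, dotProduct, Fin.sum_univ_two]
    rw [← hdet, show a₁ = -(A 0 0 + A 1 1) by linarith]
    ring
  obtain ⟨hy, hz⟩ := tendsto_zero_of_relay hγ ha₁ ha₂ (y := fun t => C ⬝ᵥ x t)
    (z := fun t => d ⬝ᵥ x t)
    (fun T hT => (dotCLM C).lipschitz.comp_absolutelyContinuousOnInterval (hx.1 T hT))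
    (fun T hT => (dotCLM d).lipschitz.comp_absolutelyContinuousOnInterval (hx.1 T hT)) (by
      filter_upwards [hx.2] with t ht
      obtain ⟨v, ⟨u, hu, rfl⟩, hv⟩ := ht
      refine ⟨u, hu, ?_, ?_⟩
      · have := (dotCLM C).hasFDerivAt.comp_hasDerivAt t hv
        refine this.congr_deriv ?_
        rw [dotCLM_apply, dotProduct_sub, dotProduct_smul, hCB, smul_zero, sub_zero,
          Matrix.dotProduct_mulVec]
      · have := (dotCLM d).hasFDerivAt.comp_hasDerivAt t hv
        refine this.congr_deriv ?_
        rw [dotCLM_apply, dotProduct_sub, dotProduct_smul, hdA, hdB, smul_eq_mul]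
        ring)
  have hCB' : C 0 * B 0 + C 1 * B 1 = 0 := by
    simpa [dotProduct, Fin.sum_univ_two] using hCB
  have hdB' : d 0 * B 0 + d 1 * B 1 = γ := by
    simpa [dotProduct, Fin.sum_univ_two] using hdB
  -- Observability: C annihilates B and d does not, so dependence would force C = 0 and γ = 0.
  -- Cramer's rule then recovers x from y and z.
  have hD : C 0 * d 1 - C 1 * d 0 ≠ 0 := by
    intro h0
    have h1 : C 1 * γ = 0 := by linear_combination -B 0 * h0 - C 1 * hdB' + d 1 * hCB'
    have h2 : C 0 * γ = 0 := by linear_combination B 1 * h0 - C 0 * hdB' + d 0 * hCB'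
    have h3 : C 1 = 0 := by simpa [hγ.ne'] using h1
    have h4 : C 0 = 0 := by simpa [hγ.ne'] using h2
    have : C = 0 := by ext i; fin_cases i <;> simp [h3, h4]
    rw [this, zero_dotProduct] at hCAB
    exact hγ.ne hCAB
  rw [tendsto_pi_nhds]
  intro i
  fin_cases i
  · have := ((hy.const_mul (d 1)).sub (hz.const_mul (C 1))).div_const (C 0 * d 1 - C 1 * d 0)
    simp only [mul_zero, sub_zero, zero_div] at this
    refine this.congr fun t => ?_
    rw [div_eq_iff hD]
    simp only [dotProduct, Fin.sum_univ_two, Fin.zero_eta]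
    ring
  · have := ((hz.const_mul (C 0)).sub (hy.const_mul (d 0))).div_const (C 0 * d 1 - C 1 * d 0)
    simp only [mul_zero, sub_zero, zero_div] at this
    refine this.congr fun t => ?_
    rw [div_eq_iff hD]
    simp only [dotProduct, Fin.sum_univ_two, Fin.mk_one]
    ring

/-! ### Euler schemes and their limit -/

section Euler

variable {E : Type*} [NormedAddCommGroup E] [NormedSpace ℝ E]

/-- The explicit Euler scheme with step `h` for `ẋ = A x - B sign (C x)`. -/
noncomputable def euler (A : E →L[ℝ] E) (B : E) (C : E →L[ℝ] ℝ) (h : ℝ) (x₀ : E) : ℕ → E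
  | 0 => x₀
  | k + 1 => euler A B C h x₀ k +
      h • (A (euler A B C h x₀ k) - Real.sign (C (euler A B C h x₀ k)) • B)

/-- The integral of the relay output along the Euler scheme. -/
noncomputable def eulerControl (A : E →L[ℝ] E) (B : E) (C : E →L[ℝ] ℝ) (h : ℝ) (x₀ : E) : ℕ → ℝ
  | 0 => 0
  | k + 1 => eulerControl A B C h x₀ k + h * Real.sign (C (euler A B C h x₀ k))

/-- A bound for the speed of the Euler scheme up to time `T`. -/
noncomputable def speedBound (A : E →L[ℝ] E) (B x₀ : E) (T : ℝ) : ℝ :=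
  ‖A‖ * ((‖x₀‖ + 1) * Real.exp ((‖A‖ + ‖B‖) * T)) + ‖B‖

theorem abs_sign_le_one (y : ℝ) : |Real.sign y| ≤ 1 := by
  rcases Real.sign_apply_eq y with h | h | h <;> simp [h]

theorem speedBound_nonneg (A : E →L[ℝ] E) (B x₀ : E) (T : ℝ) : 0 ≤ speedBound A B x₀ T := by
  unfold speedBound
  positivity

variable (A : E →L[ℝ] E) (B : E) (C : E →L[ℝ] ℝ) {h : ℝ} (x₀ : E)

/-- Discrete Gronwall; the added 1 absorbs the constant forcing ‖B‖. -/
theorem norm_euler_le (hh : 0 ≤ h) (k : ℕ) :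
    ‖euler A B C h x₀ k‖ + 1 ≤ (‖x₀‖ + 1) * Real.exp ((‖A‖ + ‖B‖) * (h * k)) := by
  induction k with
  | zero => simp [euler]
  | succ k ih =>
    set X := euler A B C h x₀ k with hX
    have h1 : ‖euler A B C h x₀ (k + 1)‖ ≤ ‖X‖ + h * (‖A‖ * ‖X‖ + ‖B‖) := by
      rw [euler, ← hX]
      refine (norm_add_le _ _).trans ?_
      rw [norm_smul, Real.norm_of_nonneg hh]
      gcongr
      refine (norm_sub_le _ _).trans (add_le_add (A.le_opNorm X) ?_)
      rw [norm_smul, Real.norm_eq_abs]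
      exact mul_le_of_le_one_left (norm_nonneg B) (abs_sign_le_one _)
    have h2 : ‖euler A B C h x₀ (k + 1)‖ + 1 ≤ (‖X‖ + 1) * ((‖A‖ + ‖B‖) * h + 1) := by
      have e1 : 0 ≤ h * ‖A‖ := by positivity
      have e2 : 0 ≤ h * ‖B‖ * ‖X‖ := by positivity
      nlinarith
    calc ‖euler A B C h x₀ (k + 1)‖ + 1 ≤ (‖X‖ + 1) * ((‖A‖ + ‖B‖) * h + 1) := h2
      _ ≤ (‖x₀‖ + 1) * Real.exp ((‖A‖ + ‖B‖) * (h * k)) * Real.exp ((‖A‖ + ‖B‖) * h) := by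
          gcongr
          exact Real.add_one_le_exp _
      _ = (‖x₀‖ + 1) * Real.exp ((‖A‖ + ‖B‖) * (h * (k + 1 : ℕ))) := by
          rw [mul_assoc, ← Real.exp_add]
          congr 2
          push_cast
          ring

theorem norm_euler_le_of_le (hh : 0 ≤ h) {k : ℕ} {T : ℝ} (hk : h * k ≤ T) :
    ‖euler A B C h x₀ k‖ ≤ (‖x₀‖ + 1) * Real.exp ((‖A‖ + ‖B‖) * T) := by
  have h1 := norm_euler_le A B C x₀ hh k
  have h2 : (‖x₀‖ + 1) * Real.exp ((‖A‖ + ‖B‖) * (h * k))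
      ≤ (‖x₀‖ + 1) * Real.exp ((‖A‖ + ‖B‖) * T) := by gcongr
  linarith

theorem norm_euler_sub_le (hh : 0 ≤ h) {T : ℝ} {k l : ℕ} (hkl : k ≤ l) (hl : h * l ≤ T) :
    ‖euler A B C h x₀ l - euler A B C h x₀ k‖ ≤ speedBound A B x₀ T * (h * l - h * k) := by
  induction l, hkl using Nat.le_induction with
  | base => simp
  | succ l hkl ih =>
    push_cast at hl
    have hl' : h * l ≤ T := by linarith
    have hX := norm_euler_le_of_le A B C x₀ hh hl'
    have ih := ih hl'
    set X := euler A B C h x₀ l with hXdef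
    have h1 : ‖h • (A X - Real.sign (C X) • B)‖ ≤ h * speedBound A B x₀ T := by
      rw [norm_smul, Real.norm_of_nonneg hh]
      gcongr
      refine (norm_sub_le _ _).trans (add_le_add ((A.le_opNorm X).trans (by gcongr)) ?_)
      rw [norm_smul, Real.norm_eq_abs]
      exact mul_le_of_le_one_left (norm_nonneg B) (abs_sign_le_one _)
    rw [euler, ← hXdef, add_sub_right_comm]
    refine (norm_add_le _ _).trans ((add_le_add ih h1).trans (le_of_eq ?_))
    push_cast
    ring

/-- Freezing the state at step k costs at most ‖A‖ times speed times elapsed time per unit time. The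
quadratic bound does not degenerate as h → 0, so it yields the derivative of the limit. -/
theorem norm_euler_linearization_le (hh : 0 ≤ h) {T : ℝ} {k l : ℕ} (hkl : k ≤ l)
    (hl : h * l ≤ T) :
    ‖euler A B C h x₀ l - euler A B C h x₀ k - (h * l - h * k) • A (euler A B C h x₀ k)
        + (eulerControl A B C h x₀ l - eulerControl A B C h x₀ k) • B‖
      ≤ ‖A‖ * speedBound A B x₀ T * (h * l - h * k) ^ 2 := by
  induction l, hkl using Nat.le_induction with
  | base => simp
  | succ l hkl ih =>
    push_cast at hl
    have hl' : h * l ≤ T := by linarith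
    have hd := norm_euler_sub_le A B C x₀ hh hkl hl'
    have ih := ih hl'
    have hM := speedBound_nonneg A B x₀ T
    have hkl' : h * k ≤ h * l := by gcongr
    rw [euler, eulerControl]
    set X := euler A B C h x₀ l
    set Y := euler A B C h x₀ k
    set U := eulerControl A B C h x₀ l
    set V := eulerControl A B C h x₀ k
    have hsplit : X + h • (A X - Real.sign (C X) • B) - Y - (h * (l + 1 : ℕ) - h * k) • A Y
        + (U + h * Real.sign (C X) - V) • B
        = (X - Y - (h * l - h * k) • A Y + (U - V) • B) + h • A (X - Y) := by
      push_cast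
      rw [map_sub]
      module
    have h1 : ‖h • A (X - Y)‖ ≤ h * (‖A‖ * (speedBound A B x₀ T * (h * l - h * k))) := by
      rw [norm_smul, Real.norm_of_nonneg hh]
      gcongr
      exact (A.le_opNorm _).trans (by gcongr)
    rw [hsplit]
    refine (norm_add_le _ _).trans ((add_le_add ih h1).trans ?_)
    push_cast
    have e1 : 0 ≤ ‖A‖ * speedBound A B x₀ T := by positivity
    have e2 : 0 ≤ h * (h * l - h * k) := mul_nonneg hh (by linarith)
    nlinarith [mul_nonneg e1 e2, mul_nonneg e1 (mul_self_nonneg h)]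

theorem abs_eulerControl_sub_le (hh : 0 ≤ h) {k l : ℕ} (hkl : k ≤ l) :
    |eulerControl A B C h x₀ l - eulerControl A B C h x₀ k| ≤ h * l - h * k := by
  induction l, hkl using Nat.le_induction with
  | base => simp
  | succ l hkl ih =>
    rw [eulerControl, add_sub_right_comm]
    have h1 : |h * Real.sign (C (euler A B C h x₀ l))| ≤ h := by
      rw [abs_mul, abs_of_nonneg hh]
      exact mul_le_of_le_one_right hh (abs_sign_le_one _)
    refine (abs_add_le _ _).trans ((add_le_add ih h1).trans (le_of_eq ?_))
    push_cast
    ring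

theorem eulerControl_sub_eq {σ : ℝ} {k l : ℕ} (hkl : k ≤ l)
    (hσ : ∀ j, k ≤ j → j < l → Real.sign (C (euler A B C h x₀ j)) = σ) :
    eulerControl A B C h x₀ l - eulerControl A B C h x₀ k = σ * (h * l - h * k) := by
  induction l, hkl using Nat.le_induction with
  | base => simp
  | succ l hkl ih =>
    rw [eulerControl, add_sub_right_comm, ih fun j hkj hjl => hσ j hkj (by omega),
      hσ l hkl l.lt_succ_self]
    push_cast
    ring

theorem sign_eq_of_mul_pos {σ y : ℝ} (hσ : σ = 1 ∨ σ = -1) (hy : 0 < σ * y) :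
    Real.sign y = σ := by
  rcases hσ with rfl | rfl
  · exact Real.sign_of_pos (by linarith)
  · exact Real.sign_of_neg (by linarith)

/-- A bounded sequence in a proper space converges along every ultrafilter. -/
theorem exists_tendsto_ultrafilter {F : Type*} [NormedAddCommGroup F] [ProperSpace F]
    (𝒰 : Ultrafilter ℕ) {v : ℕ → F} {R : ℝ} (hv : ∀ n, ‖v n‖ ≤ R) :
    ∃ a, Tendsto v 𝒰 (𝓝 a) := by
  obtain ⟨a, -, ha⟩ := (isCompact_closedBall (0 : F) R).ultrafilter_le_nhds' (𝒰.map v)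
    (Ultrafilter.mem_map.2 (Filter.mem_of_superset Filter.univ_mem fun n _ => by simpa using hv n))
  exact ⟨a, ha⟩

/-- A limit of Euler schemes with vanishing step: a state `x` driven by an integrated control `U`
that follows the sign of `C x`. -/
theorem exists_euler_limit [ProperSpace E] : ∃ (x : ℝ → E) (U : ℝ → ℝ), x 0 = x₀ ∧
    (∀ T s t : ℝ, 0 ≤ s → s ≤ t → t ≤ T → ‖x t - x s‖ ≤ speedBound A B x₀ T * (t - s)) ∧
    (∀ T s t : ℝ, 0 ≤ s → s ≤ t → t ≤ T → ‖x t - x s - (t - s) • A (x s) + (U t - U s) • B‖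
      ≤ ‖A‖ * speedBound A B x₀ T * (t - s) ^ 2) ∧
    (∀ s t : ℝ, 0 ≤ s → s ≤ t → |U t - U s| ≤ t - s) ∧
    ∀ T s p t σ : ℝ, 0 ≤ s → s ≤ p → p ≤ t → t ≤ T → (σ = 1 ∨ σ = -1) →
      ‖C‖ * (speedBound A B x₀ T * (t - s)) < σ * C (x p) → U t - U s = σ * (t - s) := by
  set h : ℕ → ℝ := fun n => ((n : ℝ) + 1)⁻¹ with hh_def
  set k : ℕ → ℝ → ℕ := fun n t => ⌊t * ((n : ℝ) + 1)⌋₊ with hk_def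
  have hh : ∀ n, 0 ≤ h n := fun n => by positivity
  have hk_mono : ∀ n {s t : ℝ}, s ≤ t → k n s ≤ k n t := fun n s t hst =>
    Nat.floor_le_floor (by gcongr)
  have hk_le : ∀ n {t T : ℝ}, 0 ≤ t → t ≤ T → h n * k n t ≤ T := by
    intro n t T ht htT
    refine le_trans ?_ htT
    rw [hh_def, inv_mul_le_iff₀ (by positivity), mul_comm]
    exact Nat.floor_le (by positivity)
  -- One ultrafilter gives limits at all times at once, in place of Arzelà–Ascoli and subsequences.
  set 𝒰 : Ultrafilter ℕ := hyperfilter ℕ with h𝒰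
  have hτ : ∀ {t : ℝ}, 0 ≤ t → Tendsto (fun n => h n * k n t) 𝒰 (𝓝 t) := by
    intro t ht
    have h1 : Tendsto (fun n : ℕ => (n : ℝ) + 1) atTop atTop :=
      tendsto_atTop_add_const_right _ _ tendsto_natCast_atTop_atTop
    have h2 := ((tendsto_nat_floor_mul_div_atTop ht).comp h1).mono_left
      Nat.hyperfilter_le_atTop
    refine h2.congr fun n => ?_
    simp [hh_def, hk_def, div_eq_inv_mul]
  have hXlim : ∀ t : ℝ, ∃ a, 0 ≤ t → Tendsto (fun n => euler A B C (h n) x₀ (k n t)) 𝒰 (𝓝 a) := by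
    intro t
    by_cases ht : 0 ≤ t
    · obtain ⟨a, ha⟩ := exists_tendsto_ultrafilter 𝒰
        fun n => norm_euler_le_of_le A B C x₀ (hh n) (hk_le n ht le_rfl)
      exact ⟨a, fun _ => ha⟩
    · exact ⟨0, fun h => absurd h ht⟩
  have hUlim : ∀ t : ℝ, ∃ a : ℝ, 0 ≤ t →
      Tendsto (fun n => eulerControl A B C (h n) x₀ (k n t)) 𝒰 (𝓝 a) := by
    intro t
    by_cases ht : 0 ≤ t
    · obtain ⟨a, ha⟩ := exists_tendsto_ultrafilter 𝒰 (R := t)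
        (v := fun n => eulerControl A B C (h n) x₀ (k n t)) fun n => by
          have := abs_eulerControl_sub_le A B C x₀ (hh n) (Nat.zero_le (k n t))
          simp only [eulerControl, sub_zero, Nat.cast_zero, mul_zero] at this
          exact this.trans (hk_le n ht le_rfl)
      exact ⟨a, fun _ => ha⟩
    · exact ⟨0, fun h => absurd h ht⟩
  choose x hx using hXlim
  choose U hU using hUlim
  refine ⟨x, U, ?_, ?_, ?_, ?_, ?_⟩
  · refine tendsto_nhds_unique (hx 0 le_rfl) ?_
    simp [hk_def, euler]
  · intro T s t hs hst htT
    have ht := hs.trans hst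
    refine le_of_tendsto_of_tendsto' ((hx t ht).sub (hx s hs)).norm
      (((hτ ht).sub (hτ hs)).const_mul _) fun n => ?_
    exact norm_euler_sub_le A B C x₀ (hh n) (hk_mono n hst) (hk_le n ht htT)
  · intro T s t hs hst htT
    have ht := hs.trans hst
    refine le_of_tendsto_of_tendsto'
      ((((hx t ht).sub (hx s hs)).sub (((hτ ht).sub (hτ hs)).smul
        ((A.continuous.tendsto _).comp (hx s hs)))).add
        (((hU t ht).sub (hU s hs)).smul_const B)).norm
      ((((hτ ht).sub (hτ hs)).pow 2).const_mul _) fun n => ?_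
    exact norm_euler_linearization_le A B C x₀ (hh n) (hk_mono n hst) (hk_le n ht htT)
  · intro s t hs hst
    have ht := hs.trans hst
    refine le_of_tendsto_of_tendsto' ((hU t ht).sub (hU s hs)).abs ((hτ ht).sub (hτ hs))
      fun n => ?_
    exact abs_eulerControl_sub_le A B C x₀ (hh n) (hk_mono n hst)
  -- The threshold bounds the variation of Cx on [s, t], so the strict inequality at p fixes the
  -- sign at every Euler step in the window, for almost all n.
  · intro T s p t σ hs hsp hpt htT hσ hlt
    have hp := hs.trans hsp
    have ht := hp.trans hpt
    have hev := ((((hτ ht).sub (hτ hs)).const_mul (speedBound A B x₀ T)).const_mul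
      ‖C‖).eventually_lt (((C.continuous.tendsto _).comp (hx p hp)).const_mul σ) hlt
    refine tendsto_nhds_unique ((hU t ht).sub (hU s hs)) ?_
    refine (((hτ ht).sub (hτ hs)).const_mul σ).congr' ?_
    filter_upwards [hev] with n hn
    refine (eulerControl_sub_eq A B C x₀ (hk_mono n (hsp.trans hpt)) fun j hsj hjt => ?_).symm
    refine sign_eq_of_mul_pos hσ ?_
    set Y := euler A B C (h n) x₀ (k n p) with hY
    have hM := speedBound_nonneg A B x₀ T
    have hjT : h n * j ≤ T := by
      have : h n * j ≤ h n * k n t := by have := hh n; gcongr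
      exact this.trans (hk_le n ht htT)
    have hd : ‖euler A B C (h n) x₀ j - Y‖
        ≤ speedBound A B x₀ T * (h n * k n t - h n * k n s) := by
      have h0 := hh n
      have e1 : h n * j ≤ h n * k n t := by gcongr
      have e2 : h n * k n s ≤ h n * j := by gcongr
      have e3 : h n * k n p ≤ h n * k n t := by gcongr; exact hk_mono n hpt
      have e4 : h n * k n s ≤ h n * k n p := by gcongr; exact hk_mono n hsp
      rcases le_total j (k n p) with hjp | hjp
      · rw [norm_sub_rev]
        refine (norm_euler_sub_le A B C x₀ h0 hjp (hk_le n hp (hpt.trans htT))).trans ?_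
        gcongr
      · refine (norm_euler_sub_le A B C x₀ h0 hjp hjT).trans ?_
        gcongr
    have hCd : |C (euler A B C (h n) x₀ j - Y)|
        ≤ ‖C‖ * (speedBound A B x₀ T * (h n * k n t - h n * k n s)) :=
      (C.le_opNorm _).trans (by gcongr)
    have hn' : ‖C‖ * (speedBound A B x₀ T * (h n * k n t - h n * k n s)) < σ * C Y := hn
    rw [map_sub, abs_le] at hCd
    rcases hσ with rfl | rfl <;> linarith [hCd.1, hCd.2]

end Euler

/-! ### The Euler limit is a Filippov solution -/

/-- From every initial state there starts a trajectory of the relay feedback system. -/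
theorem exists_isTrajectory (A : Matrix (Fin 2) (Fin 2) ℝ) (B C x₀ : Fin 2 → ℝ) :
    ∃ x : ℝ → Fin 2 → ℝ, IsTrajectory A B C x ∧ x 0 = x₀ := by
  set L : (Fin 2 → ℝ) →L[ℝ] (Fin 2 → ℝ) := LinearMap.toContinuousLinearMap A.mulVecLin with hL
  have hLA : ∀ v, L v = A *ᵥ v := fun v => rfl
  obtain ⟨x, U, hx0, hxlip, hxlin, hUlip, hUsign⟩ := exists_euler_limit L B (dotCLM C) x₀
  set M := speedBound L B x₀ with hM_def
  have hM : ∀ T, 0 ≤ M T := speedBound_nonneg L B x₀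
  have hULip : LipschitzOnWith 1 U (Set.Ici 0) := by
    refine LipschitzOnWith.of_dist_le_mul fun t ht s hs => ?_
    rw [Real.dist_eq, Real.dist_eq, NNReal.coe_one, one_mul]
    rcases le_total s t with hst | hst
    · exact (hUlip s t hs hst).trans (le_abs_self _)
    · rw [abs_sub_comm, abs_sub_comm t]
      exact (hUlip t s ht hst).trans (le_abs_self _)
  have hUderiv : ∀ t σ : ℝ, 0 < t → (σ = 1 ∨ σ = -1) → 0 < σ * (C ⬝ᵥ x t) →
      HasDerivAt U σ t := by
    intro t σ ht hσ hpos
    have hcont : Tendsto (fun s => ‖dotCLM C‖ * (M (t + 1) * |s - t|)) (𝓝 t) (𝓝 0) := by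
      have : Continuous fun s => ‖dotCLM C‖ * (M (t + 1) * |s - t|) := by fun_prop
      simpa using this.tendsto t
    -- Short windows ending or starting at t have constant sign σ, so U is affine near t.
    have hev : U =ᶠ[𝓝 t] fun s => U t + σ * (s - t) := by
      filter_upwards [hcont.eventually_lt_const hpos, lt_mem_nhds ht,
        gt_mem_nhds (lt_add_one t)] with s hs hs0 hs1
      rcases le_total s t with hst | hst
      · rw [abs_sub_comm, abs_of_nonneg (sub_nonneg.2 hst)] at hs
        linarith [hUsign (t + 1) s t t σ hs0.le hst le_rfl (by linarith) hσ hs]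
      · rw [abs_of_nonneg (sub_nonneg.2 hst)] at hs
        linarith [hUsign (t + 1) t t s σ ht.le le_rfl hst hs1.le hσ hs]
    refine HasDerivAt.congr_of_eventuallyEq ?_ hev
    simpa using (((hasDerivAt_id t).sub_const t).const_mul σ).const_add (U t)
  have hxderiv : ∀ t u : ℝ, 0 < t → HasDerivAt U u t → HasDerivAt x (A *ᵥ x t - u • B) t := by
    intro t u ht hu
    have hquad : (fun s => x s - x t - (s - t) • L (x t) + (U s - U t) • B)
        =o[𝓝 t] fun s => s - t := by
      refine Asymptotics.IsBigO.trans_isLittleO (g := fun s => (s - t) ^ 2) ?_ ?_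
      -- The factor 2 pays for s < t, where the estimate is based at s and must be moved to t.
      · refine Asymptotics.IsBigO.of_bound (2 * (‖L‖ * M (t + 1))) ?_
        filter_upwards [lt_mem_nhds ht, gt_mem_nhds (lt_add_one t)] with s hs0 hs1
        have hpos : 0 ≤ ‖L‖ * M (t + 1) * (s - t) ^ 2 := by
          have := hM (t + 1)
          positivity
        rw [Real.norm_of_nonneg (sq_nonneg (s - t))]
        rcases le_total s t with hst | hst
        · have e1 := hxlin (t + 1) s t hs0.le hst (by linarith)
          have e2 := hxlip (t + 1) s t hs0.le hst (by linarith)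
          have e3 : ‖(t - s) • L (x t - x s)‖ ≤ ‖L‖ * M (t + 1) * (t - s) ^ 2 := by
            rw [norm_smul, Real.norm_of_nonneg (sub_nonneg.2 hst)]
            calc (t - s) * ‖L (x t - x s)‖ ≤ (t - s) * (‖L‖ * (M (t + 1) * (t - s))) := by
                  refine mul_le_mul_of_nonneg_left ((L.le_opNorm _).trans ?_) (sub_nonneg.2 hst)
                  gcongr
              _ = _ := by ring
          have e4 : x s - x t - (s - t) • L (x t) + (U s - U t) • B
              = -(x t - x s - (t - s) • L (x s) + (U t - U s) • B) + (t - s) • L (x t - x s) := by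
            rw [map_sub]
            module
          rw [e4]
          refine (norm_add_le _ _).trans ?_
          rw [norm_neg]
          linarith
        · have := hxlin (t + 1) t s ht.le hst hs1.le
          linarith
      · have : (fun s : ℝ => (s - t) * (s - t)) =o[𝓝 t] fun s => 1 * (s - t) := by
          refine Asymptotics.IsLittleO.mul_isBigO ?_ (Asymptotics.isBigO_refl _ _)
          rw [Asymptotics.isLittleO_one_iff]
          have : Continuous fun s : ℝ => s - t := by fun_prop
          simpa using this.tendsto t
        simpa [sq] using this
    rw [hasDerivAt_iff_isLittleO] at hu ⊢
    have hB : (fun s => (U s - U t - (s - t) • u) • B) =o[𝓝 t] fun s => s - t := by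
      refine Asymptotics.IsBigO.trans_isLittleO ?_ hu
      refine Asymptotics.IsBigO.of_bound ‖B‖ (Eventually.of_forall fun s => ?_)
      rw [norm_smul, mul_comm]
    refine (hquad.sub hB).congr_left fun s => ?_
    rw [← hLA, smul_eq_mul]
    module
  refine ⟨x, ⟨fun T hT => ?_, ?_⟩, hx0⟩
  · refine LipschitzOnWith.absolutelyContinuousOnInterval (K := (M T).toNNReal)
      (LipschitzOnWith.of_dist_le_mul fun t ht s hs => ?_)
    rw [Set.uIcc_of_le hT.le] at ht hs
    rw [dist_eq_norm, Real.dist_eq, Real.coe_toNNReal _ (hM T)]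
    rcases le_total s t with hst | hst
    · rw [abs_of_nonneg (sub_nonneg.2 hst)]
      exact hxlip T s t hs.1 hst ht.2
    · rw [norm_sub_rev, abs_sub_comm, abs_of_nonneg (sub_nonneg.2 hst)]
      exact hxlip T t s ht.1 hst hs.2
  · rw [ae_restrict_iff' measurableSet_Ici]
    -- Time 0 is discarded because the derivative is two-sided while the bounds hold only on [0, ∞).
    filter_upwards [hULip.ae_differentiableWithinAt_of_mem_real, Measure.ae_ne volume (0 : ℝ)]
      with t hdiff hne ht
    have ht0 : 0 < t := lt_of_le_of_ne ht (Ne.symm hne)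
    have hnhds : Set.Ici (0 : ℝ) ∈ 𝓝 t := Ici_mem_nhds ht0
    have hd := ((hdiff ht).differentiableAt hnhds).hasDerivAt
    refine ⟨A *ᵥ x t - deriv U t • B, ⟨deriv U t, ?_, rfl⟩, hxderiv t _ ht0 hd⟩
    unfold relay
    split_ifs with h1 h2
    · exact (hUderiv t 1 ht0 (Or.inl rfl) (by linarith)).deriv
    · exact (hUderiv t (-1) ht0 (Or.inr rfl) (by linarith)).deriv
    · have := hd.le_of_lipschitzOn hnhds hULip
      rwa [NNReal.coe_one, Real.norm_eq_abs, abs_le] at this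

end RelayFeedback

theorem mainTheorem3 (γ a₁ a₂ : ℝ) (hγ : 0 < γ) (ha₁ : 0 < a₁) (ha₂ : 0 < a₂)
    (A : Matrix (Fin 2) (Fin 2) ℝ) (B C : Fin 2 → ℝ)
    (hplant : RelayFeedback.transferFunction A B C =
      RatFunc.C γ / (RatFunc.X ^ 2 + RatFunc.C a₁ * RatFunc.X + RatFunc.C a₂)) :
    (∀ x₀ : Fin 2 → ℝ, ∃ x : ℝ → Fin 2 → ℝ, RelayFeedback.IsTrajectory A B C x ∧ x 0 = x₀) ∧
      ∀ x : ℝ → Fin 2 → ℝ, RelayFeedback.IsTrajectory A B C x →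
        Tendsto x atTop (𝓝 0) := by
  obtain ⟨hCB, hCAB, htr, hdet⟩ := RelayFeedback.markov_of_transferFunction_eq hγ.ne' hplant
  exact ⟨RelayFeedback.exists_isTrajectory A B C,
    fun x hx => hx.tendsto_zero hγ ha₁ ha₂ hCB hCAB htr hdet⟩
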